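/- Let $S^1=\mathbb{R}/\mathbb{Z}$, let $r\in\{2,3,4,\dots\}\cup\{\infty\}$, let $d\ge 2$ be an integer, and let $f:S^1\to S^1$ be an orientation-preserving expanding endomorphism of class $C^r$ and degree $d$; expanding means that there is $\lambda>1$ with $|Df(x)|>\lambda$ for every $x\in S^1$. Let $E_d:S^1\to S^1$, $E_d(x)=dx \pmod 1$. Then the following are equivalent. (i) $f$ is $C^r$ conjugate to $E_d$, i.e. there is a homeomorphism $h:S^1\to S^1$ such that $h$ and $h^{-1}$ are of class $C^r$ and $f\circ h=h\circ E_d$. (ii) The Lyapunov exponent of $f$ is constant on the set $\mathrm{Per}(f)$ of periodic points of $f$, i.e. there is $\ell\in\mathbb{R}$ such that $\lim_{n\to\infty}\frac1n\log|Df^n(p)|=\ell$ for every $p\in\mathrm{Per}(f)$. -/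

import Mathlib

open Filter Topology
open scoped ContDiff

noncomputable section

namespace CircleDynamics

/-- `F : ℝ → ℝ` is a lift of the circle map `f`, where the circle is `ℝ / ℤ`. -/
def IsLift (F : ℝ → ℝ) (f : UnitAddCircle → UnitAddCircle) : Prop :=
  Continuous F ∧ ∀ t : ℝ, ((F t : ℝ) : UnitAddCircle) = f (t : UnitAddCircle)

/-- A circle map is of class `C^r` (`r` a natural number or `∞`) if it has a `C^r` lift. -/
def IsCr (r : ℕ∞) (f : UnitAddCircle → UnitAddCircle) : Prop :=
  ∃ F : ℝ → ℝ, IsLift F f ∧ ContDiff ℝ (r : ℕ∞ω) F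

/-- A circle map has degree `d` if it has a lift `F` with `F (t + 1) = F t + d` for all `t`. -/
def HasDegree (f : UnitAddCircle → UnitAddCircle) (d : ℤ) : Prop :=
  ∃ F : ℝ → ℝ, IsLift F f ∧ ∀ t : ℝ, F (t + 1) = F t + d

/-- The representative in `[-1/2, 1/2)` of a point of the circle. -/
def rep (y : UnitAddCircle) : ℝ :=
  (AddCircle.equivIco (1 : ℝ) (-1 / 2) y : ℝ)

/-- The derivative `Df(x)` of a circle map, a real number: the derivative at `t = 0` of
`t ↦ f (x + t) - f x`, read in the chart `rep` around `0`. -/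
def circleDeriv (f : UnitAddCircle → UnitAddCircle) (x : UnitAddCircle) : ℝ :=
  deriv (fun t : ℝ => rep (f (x + (t : UnitAddCircle)) - f x)) 0

/-- `f` is expanding: there is `lam > 1` with `|Df(x)| > lam` for every `x`. -/
def IsExpanding (f : UnitAddCircle → UnitAddCircle) : Prop :=
  ∃ lam : ℝ, 1 < lam ∧ ∀ x : UnitAddCircle, lam < |circleDeriv f x|

/-- A local diffeomorphism of the circle preserves orientation if its derivative is positive. -/
def IsOrientationPreserving (f : UnitAddCircle → UnitAddCircle) : Prop :=
  ∀ x : UnitAddCircle, 0 < circleDeriv f x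

/-- The linear model `E_d (x) = d x mod 1`. -/
def linearModel (d : ℕ) (x : UnitAddCircle) : UnitAddCircle := d • x

/-- `f` and `g` are `C^r` conjugate: there is a `C^r` diffeomorphism `h` of the circle (a
homeomorphism such that `h` and its inverse are `C^r`) with `f ∘ h = h ∘ g`. -/
def CrConjugate (r : ℕ∞) (f g : UnitAddCircle → UnitAddCircle) : Prop :=
  ∃ h : UnitAddCircle ≃ₜ UnitAddCircle, IsCr r h ∧ IsCr r h.symm ∧
    ∀ x : UnitAddCircle, f (h x) = h (g x)

/-- The Lyapunov exponent of `f` at `x` exists and equals `l`: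
`(1 / n) log |D(f^n)(x)| → l` as `n → ∞`. -/
def HasLyapunovExponent (f : UnitAddCircle → UnitAddCircle) (x : UnitAddCircle) (l : ℝ) : Prop :=
  Tendsto (fun n : ℕ => (1 / (n : ℝ)) * Real.log |circleDeriv (f^[n]) x|) atTop (𝓝 l)

end CircleDynamics

end

open Filter Topology
open scoped ContDiff

noncomputable section

namespace CircleDynamics


/-! A conjugacy makes `f` cohomologous to its linear model: in lifts, D(f^n)(p) equals d^n times a
quotient of two values of the derivative of the conjugacy. That derivative is periodic, continuous
and nowhere zero, so the quotient is bounded above and below, and the exponent is log d at every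
point.

Conversely, translate so that a lift F fixes 0, with multiplier μ. As F expands, it is linearized on
the whole line: L ∘ F = μ L with L' > 0 and L of class C^r (`exists_linearization`). With G the
inverse of F, the function w = L''/L' must solve w = G''/G' + G' · (w ∘ G). Since |G'| is at most a
constant below 1, the iterated series for w converges, and it is as smooth as the coefficients
(`contDiff_solution`).

The periodic data make L descend to the circle. A point with F^k(s) = s + n has multiplier μ^k, so
differentiating L ∘ F^k = μ^k L gives L'(s + n) = L'(s). Such points accumulate at 0, so L' takes
the same value at all integers. Pulling back along the dense set of iterated preimages of integers
makes L' 1-periodic (`deriv_linearization_periodic`). Hence L(t + 1) = L(t) + c, comparison with the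
degree forces μ = d, and L / c is a lift of the conjugacy. -/

/-! ### The equation w = a + b · (w ∘ G) for a contracting weight b -/

/-- The weighted composition operator `u ↦ b · (u ∘ G)`. -/
def weightedComp (b G u : ℝ → ℝ) : ℝ → ℝ := fun t => b t * u (G t)

variable {a b G w : ℝ → ℝ} {θ : ℝ}

/-- As G does not increase |t|, the interval |t| ≤ R is invariant, so each application of the
operator costs only a factor θ there. No global bound on `a` is required. -/
lemma abs_weightedComp_iterate_le (hb : ∀ t, |b t| ≤ θ) (hG : ∀ t, |G t| ≤ |t|) {R A : ℝ}
    (hA : ∀ t, |t| ≤ R → |a t| ≤ A) (n : ℕ) :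
    ∀ t, |t| ≤ R → |(weightedComp b G)^[n] a t| ≤ θ ^ n * A := by
  have hθ : 0 ≤ θ := (abs_nonneg _).trans (hb 0)
  induction n with
  | zero => simpa using hA
  | succ n ih =>
    intro t ht
    rw [Function.iterate_succ_apply']
    have h := ih (G t) ((hG t).trans ht)
    calc |b t * (weightedComp b G)^[n] a (G t)| = |b t| * |(weightedComp b G)^[n] a (G t)| :=
          abs_mul _ _
      _ ≤ θ * (θ ^ n * A) := mul_le_mul (hb t) h (abs_nonneg _) hθ
      _ = θ ^ (n + 1) * A := by ring

lemma continuous_weightedComp_iterate (ha : Continuous a) (hb : Continuous b) (hG : Continuous G)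
    (n : ℕ) : Continuous ((weightedComp b G)^[n] a) := by
  induction n with
  | zero => simpa using ha
  | succ n ih => rw [Function.iterate_succ_apply']; exact hb.mul (ih.comp hG)

lemma contDiff_weightedComp_iterate {m : ℕ∞ω} (ha : ContDiff ℝ m a) (hb : ContDiff ℝ m b)
    (hG : ContDiff ℝ m G) (n : ℕ) : ContDiff ℝ m ((weightedComp b G)^[n] a) := by
  induction n with
  | zero => simpa using ha
  | succ n ih => rw [Function.iterate_succ_apply']; exact hb.mul (ih.comp hG)

lemma exists_abs_le_of_continuous {g : ℝ → ℝ} (hg : Continuous g) (R : ℝ) :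
    ∃ A, 0 ≤ A ∧ ∀ t, |t| ≤ R → |g t| ≤ A := by
  obtain ⟨A, hA⟩ := (isCompact_Icc (a := -R) (b := R)).exists_bound_of_continuousOn
    hg.continuousOn
  exact ⟨max A 0, le_max_right _ _, fun t ht => (hA t (abs_le.1 ht)).trans (le_max_left _ _)⟩

lemma summable_weightedComp_iterate (ha : Continuous a) (hb : ∀ t, |b t| ≤ θ) (hθ : θ < 1)
    (hG : ∀ t, |G t| ≤ |t|) (t : ℝ) : Summable fun n => (weightedComp b G)^[n] a t := by
  obtain ⟨A, -, hA⟩ := exists_abs_le_of_continuous ha |t|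
  have hθ0 : 0 ≤ θ := (abs_nonneg _).trans (hb 0)
  exact Summable.of_norm_bounded ((summable_geometric_of_lt_one hθ0 hθ).mul_right A)
    fun n => abs_weightedComp_iterate_le hb hG hA n t le_rfl

/-- The equation `w = a + b · (w ∘ G)` has a continuous solution. -/
lemma exists_continuous_solution (ha : Continuous a) (hbc : Continuous b) (hGc : Continuous G)
    (hb : ∀ t, |b t| ≤ θ) (hθ : θ < 1) (hG : ∀ t, |G t| ≤ |t|) :
    Continuous (fun t => ∑' n, (weightedComp b G)^[n] a t) ∧
      ∀ t, ∑' n, (weightedComp b G)^[n] a t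
        = a t + b t * ∑' n, (weightedComp b G)^[n] a (G t) := by
  have hθ0 : 0 ≤ θ := (abs_nonneg _).trans (hb 0)
  constructor
  · rw [continuous_iff_continuousAt]
    intro t
    obtain ⟨A, -, hA⟩ := exists_abs_le_of_continuous ha (|t| + 1)
    have h : ContinuousOn (fun t => ∑' n, (weightedComp b G)^[n] a t) (Metric.ball 0 (|t| + 1)) :=
      continuousOn_tsum
        (fun n => (continuous_weightedComp_iterate ha hbc hGc n).continuousOn)
        ((summable_geometric_of_lt_one hθ0 hθ).mul_right A)
        (fun n x hx => abs_weightedComp_iterate_le hb hG hA n x (by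
          simpa using (Metric.mem_ball.1 hx).le))
    exact h.continuousAt (Metric.isOpen_ball.mem_nhds (by simp))
  · intro t
    rw [(summable_weightedComp_iterate ha hb hθ hG t).tsum_eq_zero_add, ← tsum_mul_left]
    congr 1
    exact tsum_congr fun n => by rw [Function.iterate_succ_apply']; rfl

/-- The difference of two solutions is fixed by the homogeneous operator, whose iterates tend to 0
on every bounded interval. -/
lemma solution_unique (hb : ∀ t, |b t| ≤ θ) (hθ : θ < 1) (hG : ∀ t, |G t| ≤ |t|)
    {w₁ w₂ : ℝ → ℝ} (h₁ : Continuous w₁) (h₂ : Continuous w₂)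
    (e₁ : ∀ t, w₁ t = a t + b t * w₁ (G t)) (e₂ : ∀ t, w₂ t = a t + b t * w₂ (G t)) :
    w₁ = w₂ := by
  have hθ0 : 0 ≤ θ := (abs_nonneg _).trans (hb 0)
  set e : ℝ → ℝ := w₁ - w₂ with he
  have hfix : weightedComp b G e = e := by
    funext t
    simp only [weightedComp, he, Pi.sub_apply]
    rw [e₁ t, e₂ t]; ring
  funext t
  obtain ⟨A, -, hA⟩ := exists_abs_le_of_continuous (h₁.sub h₂) |t|
  have hn : ∀ n : ℕ, |e t| ≤ θ ^ n * A := fun n => by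
    have h := abs_weightedComp_iterate_le hb hG hA n t le_rfl
    rwa [Function.iterate_fixed hfix] at h
  have hlim : Tendsto (fun n : ℕ => θ ^ n * A) atTop (𝓝 (0 * A)) :=
    (tendsto_pow_atTop_nhds_zero_of_lt_one hθ0 hθ).mul_const A
  rw [zero_mul] at hlim
  have : |e t| ≤ 0 := ge_of_tendsto' hlim hn
  exact sub_eq_zero.1 (abs_nonpos_iff.1 this)

lemma deriv_weightedComp {u : ℝ → ℝ} (hu : Differentiable ℝ u) (hb : Differentiable ℝ b)
    (hG : Differentiable ℝ G) (t : ℝ) :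
    deriv (weightedComp b G u) t = deriv b t * u (G t) + b t * (deriv u (G t) * deriv G t) :=
  ((hb t).hasDerivAt.mul ((hu (G t)).hasDerivAt.comp t (hG t).hasDerivAt)).deriv

/-- Differentiating b · (u ∘ G) leaves the unwanted term b' · (u ∘ G). The weighted norm |u'| + K|u|
absorbs it: for K large, the operator contracts this norm by ρ, at the price of enlarging θ to ρ. -/
lemma abs_deriv_weightedComp_iterate_le (ha : ContDiff ℝ 1 a) (hbc : ContDiff ℝ 1 b)
    (hGc : ContDiff ℝ 1 G) (hb : ∀ t, |b t| ≤ θ) (hG : ∀ t, |G t| ≤ |t|)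
    (hG' : ∀ t, |deriv G t| ≤ 1) {R N B K ρ : ℝ} (hK : 0 ≤ K) (hρ : θ ≤ ρ)
    (hB : ∀ t, |t| ≤ R → |deriv b t| ≤ B) (hBK : B ≤ (ρ - θ) * K)
    (hN : ∀ t, |t| ≤ R → |deriv a t| + K * |a t| ≤ N) (n : ℕ) :
    ∀ t, |t| ≤ R → |deriv ((weightedComp b G)^[n] a) t| + K * |(weightedComp b G)^[n] a t|
      ≤ ρ ^ n * N := by
  have hθ : 0 ≤ θ := (abs_nonneg _).trans (hb 0)
  induction n with
  | zero => simpa using hN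
  | succ n ih =>
    intro t ht
    have h := ih (G t) ((hG t).trans ht)
    have hu := (contDiff_weightedComp_iterate ha hbc hGc n).differentiable one_ne_zero
    rw [Function.iterate_succ_apply',
      deriv_weightedComp hu (hbc.differentiable one_ne_zero) (hGc.differentiable one_ne_zero)]
    simp only [weightedComp]
    set x := (weightedComp b G)^[n] a (G t)
    set y := deriv ((weightedComp b G)^[n] a) (G t)
    have h1 : |deriv b t * x + b t * (y * deriv G t)| ≤ B * |x| + θ * |y| := by
      refine (abs_add_le _ _).trans (add_le_add ?_ ?_)
      · rw [abs_mul]; exact mul_le_mul_of_nonneg_right (hB t ht) (abs_nonneg _)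
      · rw [abs_mul, abs_mul]
        exact mul_le_mul (hb t) (mul_le_of_le_one_right (abs_nonneg _) (hG' t))
          (by positivity) hθ
    have h2 : K * |b t * x| ≤ K * (θ * |x|) := by
      rw [abs_mul]
      exact mul_le_mul_of_nonneg_left (mul_le_mul_of_nonneg_right (hb t) (abs_nonneg _)) hK
    have h3 : B * |x| ≤ (ρ - θ) * K * |x| := mul_le_mul_of_nonneg_right hBK (abs_nonneg _)
    have h4 : θ * |y| ≤ ρ * |y| := mul_le_mul_of_nonneg_right hρ (abs_nonneg _)
    have h5 : ρ * (|y| + K * |x|) ≤ ρ * (ρ ^ n * N) :=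
      mul_le_mul_of_nonneg_left h (hθ.trans hρ)
    rw [pow_succ]
    nlinarith

/-- By uniqueness `w` is the iterated series, which can be differentiated term by term because the
derivatives decay geometrically on bounded intervals. -/
lemma contDiff_one_solution (ha : ContDiff ℝ 1 a) (hbc : ContDiff ℝ 1 b)
    (hGc : ContDiff ℝ 1 G) (hb : ∀ t, |b t| ≤ θ) (hθ : θ < 1) (hG : ∀ t, |G t| ≤ |t|)
    (hG' : ∀ t, |deriv G t| ≤ 1) (hw : Continuous w) (e : ∀ t, w t = a t + b t * w (G t)) :
    ContDiff ℝ 1 w := by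
  have hθ0 : 0 ≤ θ := (abs_nonneg _).trans (hb 0)
  obtain ⟨hsc, hse⟩ :=
    exists_continuous_solution ha.continuous hbc.continuous hGc.continuous hb hθ hG
  have hws : w = fun t => ∑' n, (weightedComp b G)^[n] a t :=
    solution_unique hb hθ hG hw hsc e hse
  have hcd := contDiff_weightedComp_iterate ha hbc hGc
  obtain ⟨ρ, hθρ, hρ⟩ := exists_between hθ
  have key : ∀ R : ℝ, ∃ N, ∀ n t, t ∈ Metric.ball (0 : ℝ) R →
      ‖deriv ((weightedComp b G)^[n] a) t‖ ≤ ρ ^ n * N := by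
    intro R
    obtain ⟨B, hB0, hB⟩ := exists_abs_le_of_continuous (hbc.continuous_deriv le_rfl) R
    have hK : 0 ≤ B / (ρ - θ) := div_nonneg hB0 (sub_nonneg.2 hθρ.le)
    obtain ⟨N, -, hN⟩ := exists_abs_le_of_continuous (g := fun t =>
      |deriv a t| + B / (ρ - θ) * |a t|)
      ((ha.continuous_deriv le_rfl).abs.add (continuous_const.mul ha.continuous.abs)) R
    refine ⟨N, fun n t ht => ?_⟩
    have h := abs_deriv_weightedComp_iterate_le ha hbc hGc hb hG hG' hK hθρ.le hB
      (by rw [mul_div_cancel₀ _ (sub_pos.2 hθρ).ne'])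
      (fun t ht => (le_abs_self _).trans (hN t ht)) n t
      (by simpa using (Metric.mem_ball.1 ht).le)
    exact (le_add_of_nonneg_right (by positivity)).trans h
  have hgeo := summable_geometric_of_lt_one (hθ0.trans hθρ.le) hρ
  have hder : ∀ t, HasDerivAt w (∑' n, deriv ((weightedComp b G)^[n] a) t) t := by
    intro t
    obtain ⟨N, hN⟩ := key (|t| + 1)
    rw [hws]
    exact hasDerivAt_tsum_of_isPreconnected (hgeo.mul_right N) Metric.isOpen_ball
      (convex_ball _ _).isPreconnected
      (fun n y _ => ((hcd n).differentiable one_ne_zero y).hasDerivAt) hN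
      (Metric.mem_ball_self (by positivity))
      (summable_weightedComp_iterate ha.continuous hb hθ hG 0) (by simp)
  rw [contDiff_one_iff_deriv]
  refine ⟨fun t => (hder t).differentiableAt, ?_⟩
  rw [show deriv w = fun t => ∑' n, deriv ((weightedComp b G)^[n] a) t from
    funext fun t => (hder t).deriv, continuous_iff_continuousAt]
  intro t
  obtain ⟨N, hN⟩ := key (|t| + 1)
  exact (continuousOn_tsum (fun n => ((hcd n).continuous_deriv le_rfl).continuousOn)
    (hgeo.mul_right N) hN).continuousAt (Metric.isOpen_ball.mem_nhds (by simp))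

/-- A continuous solution of `w = a + b · (w ∘ G)` is as smooth as the data. -/
lemma contDiff_solution (m : ℕ) : ∀ {a b w : ℝ → ℝ}, ContDiff ℝ m a → ContDiff ℝ m b →
    ContDiff ℝ (m + 1) G → (∀ t, |b t| ≤ θ) → θ < 1 → (∀ t, |G t| ≤ |t|) →
    (∀ t, |deriv G t| ≤ 1) → Continuous w → (∀ t, w t = a t + b t * w (G t)) →
    ContDiff ℝ m w := by
  induction m with
  | zero => intro a b w _ _ _ _ _ _ _ hw _; exact contDiff_zero.2 hw
  | succ m ih =>
    intro a b w ha hbc hGc hb hθ hG hG' hw e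
    push_cast at ha hbc hGc ⊢
    have hwm : ContDiff ℝ m w := ih (ha.of_le le_self_add) (hbc.of_le le_self_add)
      (hGc.of_le le_self_add) hb hθ hG hG' hw e
    have hw1 : ContDiff ℝ 1 w := contDiff_one_solution (ha.of_le le_add_self)
      (hbc.of_le le_add_self) (hGc.of_le le_add_self) hb hθ hG hG' hw e
    have hd : ∀ {g : ℝ → ℝ}, ContDiff ℝ (m + 1) g → ContDiff ℝ m (deriv g) :=
      fun hg => (contDiff_succ_iff_deriv.1 hg).2.2
    refine contDiff_succ_iff_deriv.2 ⟨hw1.differentiable one_ne_zero, by simp, ?_⟩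
    have hGm : ContDiff ℝ (m + 1) G := hGc.of_le le_self_add
    -- The derivative w' solves an equation of the same kind, with weight b · G' (still bounded by
    -- θ) and with a source containing w itself, already C^m by induction.
    refine ih (a := fun t => deriv a t + deriv b t * w (G t)) (b := fun t => b t * deriv G t)
      ((hd ha).add ((hd hbc).mul (hwm.comp (hGm.of_le le_self_add))))
      ((hbc.of_le le_self_add).mul (hd hGm)) hGm
      (fun t => ?_) hθ hG hG' (hw1.continuous_deriv le_rfl) fun t => ?_
    · rw [abs_mul]
      exact (mul_le_of_le_one_right (abs_nonneg _) (hG' t)).trans (hb t)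
    · have hne : (m + 1 : ℕ∞ω) ≠ 0 := by simp
      have hw' : w = a + weightedComp b G w := funext e
      have h1 := (ha.differentiable hne t).hasDerivAt.add
        ((hbc.differentiable hne t).hasDerivAt.mul
          ((hw1.differentiable one_ne_zero (G t)).hasDerivAt.comp t
            (hGm.differentiable hne t).hasDerivAt))
      have h2 : deriv w t = deriv (a + weightedComp b G w) t := by rw [← hw']
      refine h2.trans (h1.deriv.trans ?_)
      simp only [Function.comp]; ring


/-! ### Linearization of an expanding map of the line -/

lemma apply_add_int {F : ℝ → ℝ} {c : ℝ} (h : ∀ t, F (t + 1) = F t + c) (n : ℤ) (t : ℝ) :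
    F (t + n) = F t + c * n := by
  have hp : Function.Periodic (fun t => F t - c * t) 1 := fun t => by
    simp only [h t]; ring
  have := hp.int_mul n t
  simp only [mul_one] at this
  linarith

lemma surjective_of_add_one {F : ℝ → ℝ} {c : ℝ} (hF : Continuous F) (hc : 0 < c)
    (h : ∀ t, F (t + 1) = F t + c) : Function.Surjective F := by
  intro y
  obtain ⟨n, hn⟩ := exists_int_lt ((y - F 0) / c)
  obtain ⟨m, hm⟩ := exists_int_gt ((y - F 0) / c)
  have hn' := apply_add_int h n 0
  have hm' := apply_add_int h m 0
  rw [lt_div_iff₀ hc] at hn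
  rw [div_lt_iff₀ hc] at hm
  exact mem_range_of_exists_le_of_exists_ge hF ⟨0 + n, by rw [hn']; linarith⟩
    ⟨0 + m, by rw [hm']; linarith⟩

lemma eq_of_hasDerivAt_eq {f g f' : ℝ → ℝ} (hf : ∀ t, HasDerivAt f (f' t) t)
    (hg : ∀ t, HasDerivAt g (f' t) t) {x : ℝ} (h : f x = g x) : f = g := by
  funext t
  have := is_const_of_deriv_eq_zero (f := fun t => f t - g t)
    (fun t => ((hf t).sub (hg t)).differentiableAt)
    (fun t => ((hf t).sub (hg t)).deriv.trans (sub_self _)) t x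
  simp only [h, sub_self] at this
  linarith

/-- Global linearization of an expanding diffeomorphism of the line at its fixed point. -/
theorem exists_linearization {r : ℕ∞} (hr : 2 ≤ r) (F : ℝ ≃ₜ ℝ) (hF : ContDiff ℝ r F)
    (h0 : F 0 = 0) {lam : ℝ} (hlam : 1 < lam) (hd : ∀ t, lam ≤ deriv F t) :
    ∃ L : ℝ → ℝ, ContDiff ℝ r L ∧ (∀ t, 0 < deriv L t) ∧ ∀ t, L (F t) = deriv F 0 * L t := by
  have hlam0 : 0 < lam := one_pos.trans hlam
  have hpos : ∀ t, 0 < deriv F t := fun t => hlam0.trans_le (hd t)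
  have hr1 : (r : ℕ∞ω) ≠ 0 := by
    have : r ≠ 0 := by rintro rfl; simp at hr
    exact_mod_cast this
  have hFd : ∀ t, HasDerivAt F (deriv F t) t := fun t => (hF.differentiable hr1 t).hasDerivAt
  set G : ℝ → ℝ := ⇑F.symm
  have hG : ContDiff ℝ r G := F.contDiff_symm_deriv (fun t => (hpos t).ne') hFd hF
  have hGF : ∀ t, G (F t) = t := F.symm_apply_apply
  have hFG : ∀ t, F (G t) = t := F.apply_symm_apply
  have hG0 : G 0 = 0 := by rw [← h0, hGF, h0]
  have hGderiv : ∀ t, deriv G t = (deriv F (G t))⁻¹ := fun t =>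
    (HasDerivAt.of_local_left_inverse F.symm.continuous.continuousAt (hFd (G t)) (hpos _).ne'
      (Eventually.of_forall hFG)).deriv
  have hGd : ∀ t, HasDerivAt G (deriv G t) t := fun t => (hG.differentiable hr1 t).hasDerivAt
  have hGpos : ∀ t, 0 < deriv G t := fun t => by rw [hGderiv]; exact inv_pos.2 (hpos _)
  have hGle : ∀ t, |deriv G t| ≤ lam⁻¹ := fun t => by
    rw [abs_of_pos (hGpos t), hGderiv]
    exact inv_anti₀ hlam0 (hd _)
  have hθ : lam⁻¹ < 1 := inv_lt_one_of_one_lt₀ hlam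
  have hG1 : ∀ t, |deriv G t| ≤ 1 := fun t => (hGle t).trans hθ.le
  have hGabs : ∀ t, |G t| ≤ |t| := fun t => by
    have := Convex.norm_image_sub_le_of_norm_deriv_le (f := G) (x := 0) (y := t) (C := 1)
      (fun x _ => (hGd x).differentiableAt) (fun x _ => hG1 x) convex_univ trivial trivial
    simpa [hG0] using this
  -- Orders are written n + 2 ≤ r with n finite, which treats r = ∞ along with finite r: w will be
  -- C^n, v C^(n+1) and L C^(n+2).
  have hsm : ∀ n : ℕ, ((n + 2 : ℕ) : ℕ∞) ≤ r → ContDiff ℝ (n + 1 + 1) G := fun n hn =>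
    hG.of_le (by
      have : (((n + 2 : ℕ) : ℕ∞) : ℕ∞ω) ≤ r := WithTop.coe_le_coe.2 hn
      simpa [add_assoc, one_add_one_eq_two] using this)
  have hder : ∀ {n : ℕ} {g : ℝ → ℝ}, ContDiff ℝ (n + 1) g → ContDiff ℝ n (deriv g) :=
    fun hg => (contDiff_succ_iff_deriv.1 hg).2.2
  have hb : ∀ n : ℕ, ((n + 2 : ℕ) : ℕ∞) ≤ r → ContDiff ℝ (n + 1) (deriv G) := fun n hn =>
    (contDiff_succ_iff_deriv.1 (hsm n hn)).2.2
  have ha : ∀ n : ℕ, ((n + 2 : ℕ) : ℕ∞) ≤ r →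
      ContDiff ℝ n (fun t => deriv (deriv G) t / deriv G t) := fun n hn =>
    (hder (hb n hn)).div ((hb n hn).of_le le_self_add) fun t => (hGpos t).ne'
  have hr0 : ((0 + 2 : ℕ) : ℕ∞) ≤ r := by simpa using hr
  -- Here w plays the role of L''/L'. Its equation is the logarithmic derivative of L' = μ G' · (L'
  -- ∘ G). Integrating w gives v = log L', and integrating exp v gives L.
  obtain ⟨hwc, hwe⟩ := exists_continuous_solution (ha 0 hr0).continuous
    (hb 0 hr0).continuous hG.continuous hGle hθ hGabs
  set w : ℝ → ℝ := fun t => ∑' n, (weightedComp (deriv G) G)^[n]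
    (fun t => deriv (deriv G) t / deriv G t) t with hw
  replace hwe : ∀ t, w t = deriv (deriv G) t / deriv G t + deriv G t * w (G t) := hwe
  have hwsm : ∀ n : ℕ, ((n + 2 : ℕ) : ℕ∞) ≤ r → ContDiff ℝ n w := fun n hn =>
    contDiff_solution n (ha n hn) ((hb n hn).of_le le_self_add)
      ((hsm n hn).of_le le_self_add) hGle hθ hGabs hG1 hwc hwe
  clear_value w
  set v : ℝ → ℝ := fun t => ∫ s in (0 : ℝ)..t, w s with hv
  have hvd : ∀ t, HasDerivAt v (w t) t := fun t =>
    (hwc.integral_hasStrictDerivAt 0 t).hasDerivAt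
  have hv0 : v 0 = 0 := by simp [hv]
  clear_value v
  have hec : Continuous fun t => Real.exp (v t) :=
    Real.continuous_exp.comp (continuous_iff_continuousAt.2 fun t => (hvd t).continuousAt)
  set L : ℝ → ℝ := fun t => ∫ s in (0 : ℝ)..t, Real.exp (v s) with hL
  have hLd : ∀ t, HasDerivAt L (Real.exp (v t)) t := fun t =>
    (hec.integral_hasStrictDerivAt 0 t).hasDerivAt
  have hL0 : L 0 = 0 := by simp [hL]
  clear_value L
  have hLsm : ∀ n : ℕ, ((n + 2 : ℕ) : ℕ∞) ≤ r → ContDiff ℝ (n + 1 + 1) L := by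
    intro n hn
    have h1 : ContDiff ℝ (n + 1) v := contDiff_succ_iff_deriv.2
      ⟨fun t => (hvd t).differentiableAt, by simp, by
        rw [show deriv v = w from funext fun t => (hvd t).deriv]; exact hwsm n hn⟩
    refine contDiff_succ_iff_deriv.2 ⟨fun t => (hLd t).differentiableAt, fun h => ?_, ?_⟩
    · exact absurd h (by exact_mod_cast WithTop.coe_ne_top (a := ((n + 1 : ℕ) : ℕ∞)))
    · rw [show deriv L = fun t => Real.exp (v t) from funext fun t => (hLd t).deriv]
      exact Real.contDiff_exp.comp h1
  have hμ : 0 < deriv F 0 := hpos 0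
  -- By the equation for w both sides have derivative w, and both vanish at 0 because G'(0) = 1/μ.
  -- The same pattern, one integration higher, gives L = μ · (L ∘ G).
  have hveq : v = fun t => Real.log (deriv F 0 * deriv G t) + v (G t) := by
    refine eq_of_hasDerivAt_eq (f' := w) (x := 0) hvd (fun t => ?_) ?_
    · have h2 : HasDerivAt (deriv G) (deriv (deriv G) t) t :=
        ((hb 0 hr0).differentiable (by simp) t).hasDerivAt
      have h3 := ((h2.const_mul (deriv F 0)).log (mul_pos hμ (hGpos t)).ne').add
        ((hvd (G t)).comp t (hGd t))
      refine h3.congr_deriv ?_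
      rw [hwe t, mul_div_mul_left _ _ hμ.ne']
      ring
    · simp [hv0, hG0, hGderiv, mul_inv_cancel₀ hμ.ne']
  have hLeq : L = fun t => deriv F 0 * L (G t) := by
    refine eq_of_hasDerivAt_eq (x := 0) hLd (fun t => ?_) (by simp [hL0, hG0])
    have h3 := ((hLd (G t)).comp t (hGd t)).const_mul (deriv F 0)
    refine h3.congr_deriv ?_
    have := congrFun hveq t
    rw [this, Real.exp_add, Real.exp_log (mul_pos hμ (hGpos t))]
    ring
  refine ⟨L, contDiff_iff_forall_nat_le.2 fun m hm => ?_, fun t => ?_, fun t => ?_⟩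
  · rcases m with _ | _ | n
    · exact (hLsm 0 hr0).of_le (by simp)
    · exact (hLsm 0 hr0).of_le (by simp)
    · have := hLsm n hm
      exact_mod_cast this
  · rw [(hLd t).deriv]; exact Real.exp_pos _
  · have := congrFun hLeq (F t)
    simpa [hGF] using this

/-! ### Equal multipliers and the smooth conjugacy between lifts -/

lemma contDiff_iterate {m : ℕ∞ω} {F : ℝ → ℝ} (hF : ContDiff ℝ m F) (k : ℕ) :
    ContDiff ℝ m F^[k] := by
  induction k with
  | zero => exact contDiff_id
  | succ k ih => rw [Function.iterate_succ']; exact hF.comp ih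

lemma iterate_add_one {F : ℝ → ℝ} {d : ℕ} (h : ∀ t, F (t + 1) = F t + d) (k : ℕ) (t : ℝ) :
    F^[k] (t + 1) = F^[k] t + (d : ℝ) ^ k := by
  induction k with
  | zero => simp
  | succ k ih =>
    rw [Function.iterate_succ_apply', Function.iterate_succ_apply', ih]
    have := apply_add_int h ((d : ℤ) ^ k) (F^[k] t)
    push_cast at this
    rw [this]; ring

lemma pow_mul_abs_sub_le_iterate {F : ℝ → ℝ} {lam : ℝ} (hlam : 0 ≤ lam)
    (h : ∀ s t, lam * |s - t| ≤ |F s - F t|) (k : ℕ) (s t : ℝ) :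
    lam ^ k * |s - t| ≤ |F^[k] s - F^[k] t| := by
  induction k with
  | zero => simp
  | succ k ih =>
    rw [Function.iterate_succ_apply', Function.iterate_succ_apply', pow_succ', mul_assoc]
    exact (mul_le_mul_of_nonneg_left ih hlam).trans (h _ _)

lemma mul_abs_sub_le_of_le_deriv {F : ℝ → ℝ} (hF : Differentiable ℝ F) {lam : ℝ}
    (hd : ∀ t, lam ≤ deriv F t) (s t : ℝ) : lam * |s - t| ≤ |F s - F t| := by
  wlog h : t ≤ s generalizing s t
  · rw [abs_sub_comm s t, abs_sub_comm (F s)]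
    exact this t s (le_of_not_ge h)
  · rw [abs_of_nonneg (sub_nonneg.2 h)]
    exact (mul_sub_le_image_sub_of_le_deriv hF hd h).trans (le_abs_self _)

/-- If all periodic points have the same multiplier as the fixed point `0`, then the derivative
of a linearization is `1`-periodic. -/
theorem deriv_linearization_periodic {F L : ℝ → ℝ} (hF : ContDiff ℝ 1 F) (hL : ContDiff ℝ 1 L)
    (h0 : F 0 = 0) {lam : ℝ} (hlam : 1 < lam) (hd : ∀ t, lam ≤ deriv F t) {d : ℕ} (hd2 : 2 ≤ d)
    (hF1 : ∀ t, F (t + 1) = F t + d) {μ : ℝ} (hμ : 0 < μ) (hLF : ∀ t, L (F t) = μ * L t)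
    (hper : ∀ (k : ℕ) (n : ℤ) (t : ℝ), 0 < k → F^[k] t = t + n → deriv F^[k] t = μ ^ k) (t : ℝ) :
    deriv L (t + 1) = deriv L t := by
  have hlam0 : 0 < lam := one_pos.trans hlam
  have hFc : ∀ k, ContDiff ℝ 1 F^[k] := contDiff_iterate hF
  have hFdiff : ∀ k, Differentiable ℝ F^[k] := fun k => (hFc k).differentiable one_ne_zero
  have hLdiff : Differentiable ℝ L := hL.differentiable one_ne_zero
  have hLc : Continuous (deriv L) := hL.continuous_deriv le_rfl
  have hexp := pow_mul_abs_sub_le_iterate hlam0.le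
    (mul_abs_sub_le_of_le_deriv (hF.differentiable one_ne_zero) hd)
  have hLk : ∀ k t, L (F^[k] t) = μ ^ k * L t := by
    intro k t
    induction k with
    | zero => simp
    | succ k ih => rw [Function.iterate_succ_apply', hLF, ih]; ring
  have hchain : ∀ k t, deriv L (F^[k] t) * deriv F^[k] t = μ ^ k * deriv L t := by
    intro k t
    have h1 := (hLdiff (F^[k] t)).hasDerivAt.comp t (hFdiff k t).hasDerivAt
    have h2 := (hLdiff t).hasDerivAt.const_mul (μ ^ k)
    rw [show L ∘ F^[k] = fun t => μ ^ k * L t from funext (hLk k)] at h1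
    exact h1.unique h2
  have hpowlim : Tendsto (fun k : ℕ => lam ^ k) atTop atTop := tendsto_pow_atTop_atTop_of_one_lt hlam
  have hFz : ∀ k, F^[k] 0 = 0 := fun k => Function.iterate_fixed h0 k
  have hd0 : (0 : ℝ) < d := by exact_mod_cast (by omega : 0 < d)
  have hint : ∀ n : ℤ, deriv L n = deriv L 0 := by
    intro n
    -- The function F^(k+1)(s) - s grows by d^(k+1) - 1 > 0 over a unit step, hence takes the value
    -- n. The exponent k + 1 keeps the period positive.
    have hex : ∀ k : ℕ, ∃ s, F^[k + 1] s = s + n := by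
      intro k
      have hk : (1 : ℝ) < (d : ℝ) ^ (k + 1) :=
        one_lt_pow₀ (by exact_mod_cast (by omega : 1 < d)) (by omega)
      obtain ⟨s, hs⟩ := surjective_of_add_one (F := fun t => F^[k + 1] t - t)
        ((hFc _).continuous.sub continuous_id) (sub_pos.2 hk)
        (fun t => by rw [iterate_add_one hF1]; ring) n
      exact ⟨s, by simp only at hs; linarith⟩
    choose s hs using hex
    have hslim : Tendsto s atTop (𝓝 0) := by
      -- Expansion away from the fixed point 0 gives λ^(k+1)|s| ≤ |s + n| ≤ |s| + |n|.
      have hlim : Tendsto (fun k : ℕ => |(n : ℝ)| / (lam ^ (k + 1) + (-1))) atTop (𝓝 0) :=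
        (tendsto_atTop_add_const_right _ _
          (hpowlim.comp (tendsto_add_atTop_nat 1))).const_div_atTop _
      refine squeeze_zero_norm (fun k => ?_) hlim
      have hk : (1 : ℝ) < lam ^ (k + 1) := one_lt_pow₀ hlam (by omega)
      have h1 := hexp (k + 1) (s k) 0
      rw [hFz, hs, sub_zero, sub_zero] at h1
      have h2 := abs_add_le (s k) n
      rw [Real.norm_eq_abs, le_div_iff₀ (by linarith)]
      nlinarith
    have heq : ∀ k, deriv L (s k + n) = deriv L (s k) := by
      intro k
      have h := hchain (k + 1) (s k)
      rw [hs, hper (k + 1) n (s k) (by omega) (hs k), mul_comm] at h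
      exact mul_left_cancel₀ (pow_pos hμ _).ne' h
    have l1 : Tendsto (fun k => deriv L (s k + n)) atTop (𝓝 (deriv L (0 + n))) :=
      (hLc.tendsto _).comp (hslim.add_const _)
    have l2 : Tendsto (fun k => deriv L (s k)) atTop (𝓝 (deriv L 0)) :=
      (hLc.tendsto _).comp hslim
    simp only [heq, zero_add] at l1
    exact tendsto_nhds_unique l1 l2
  have hsurj : ∀ k, Function.Surjective F^[k] := fun k =>
    surjective_of_add_one (hFc k).continuous (pow_pos hd0 k) (iterate_add_one hF1 k)
  -- The k-th preimage of the integer nearest below F^k(t) lies within λ^(-k) of t. Since s + 1 is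
  -- again sent to an integer by F^k, `hint` compares L' at s and s + 1.
  choose s hs using fun k : ℕ => hsurj k (⌊F^[k] t⌋ : ℝ)
  have hslim : Tendsto s atTop (𝓝 t) := by
    rw [tendsto_iff_norm_sub_tendsto_zero]
    refine squeeze_zero (fun k => norm_nonneg _) (fun k => ?_)
      (tendsto_inv_atTop_zero.comp hpowlim)
    have h1 := hexp k (s k) t
    rw [hs] at h1
    have h2 : |(⌊F^[k] t⌋ : ℝ) - F^[k] t| ≤ 1 := by
      rw [abs_le]; constructor <;> linarith [Int.floor_le (F^[k] t), Int.lt_floor_add_one (F^[k] t)]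
    simp only [Function.comp]
    rw [Real.norm_eq_abs, inv_eq_one_div, le_div_iff₀ (pow_pos hlam0 k), mul_comm]
    exact h1.trans h2
  have hperiodic : ∀ k, deriv L (s k + 1) = deriv L (s k) := by
    intro k
    have e1 := hchain k (s k)
    have e2 := hchain k (s k + 1)
    have e3 : deriv F^[k] (s k + 1) = deriv F^[k] (s k) := by
      rw [← deriv_comp_add_const, show (fun x => F^[k] (x + 1)) = fun x => F^[k] x + (d : ℝ) ^ k
        from funext (iterate_add_one hF1 k), deriv_add_const]
    rw [hs, hint] at e1
    have h4 := hint (⌊F^[k] t⌋ + (d : ℤ) ^ k)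
    push_cast at h4
    rw [iterate_add_one hF1, hs, h4, e3, e1] at e2
    exact (mul_left_cancel₀ (pow_pos hμ _).ne' e2).symm
  have l1 : Tendsto (fun k => deriv L (s k + 1)) atTop (𝓝 (deriv L (t + 1))) :=
    (hLc.tendsto _).comp (hslim.add_const _)
  simp only [hperiodic] at l1
  exact tendsto_nhds_unique l1 ((hLc.tendsto _).comp hslim)

/-- A lift of an expanding circle map all of whose periodic points have the same exponent is
`C^r` conjugate to multiplication by the degree; here with the fixed point at `0`. -/
theorem exists_homeomorph_semiconj_mul_of_fixed_zero {r : ℕ∞} (hr : 2 ≤ r) {F : ℝ → ℝ}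
    (hF : ContDiff ℝ r F) (h0 : F 0 = 0)
    {lam : ℝ} (hlam : 1 < lam) (hd : ∀ t, lam ≤ deriv F t) {d : ℕ} (hd2 : 2 ≤ d)
    (hF1 : ∀ t, F (t + 1) = F t + d) {μ : ℝ}
    (hper : ∀ (k : ℕ) (n : ℤ) (t : ℝ), 0 < k → F^[k] t = t + n → deriv F^[k] t = μ ^ k) :
    ∃ H : ℝ ≃ₜ ℝ, ContDiff ℝ r H ∧ ContDiff ℝ r H.symm ∧ (∀ t, H (t + 1) = H t + 1) ∧
      ∀ t, H (F t) = d * H t := by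
  have hr1 : (1 : ℕ∞ω) ≤ r := by exact_mod_cast (one_le_two.trans hr)
  have hr0 : (r : ℕ∞ω) ≠ 0 := (one_pos.trans_le hr1).ne'
  have hd0 : (0 : ℝ) < d := by exact_mod_cast (by omega : 0 < d)
  have hFm : StrictMono F := strictMono_of_deriv_pos fun t =>
    (one_pos.trans hlam).trans_le (hd t)
  let e : ℝ ≃ₜ ℝ := (StrictMono.orderIsoOfSurjective F hFm
    (surjective_of_add_one hF.continuous hd0 hF1)).toHomeomorph
  have he : ⇑e = F := rfl
  obtain ⟨L, hL, hLpos, hLF⟩ := exists_linearization hr e (he ▸ hF) (he ▸ h0) hlam (he ▸ hd)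
  rw [he] at hLF
  have hμ : deriv F 0 = μ := by simpa using hper 1 0 0 one_pos (by simpa using h0)
  have hμ0 : 0 < μ := hμ ▸ (one_pos.trans hlam).trans_le (hd 0)
  rw [hμ] at hLF
  have hLper := deriv_linearization_periodic (hF.of_le hr1) (hL.of_le hr1) h0 hlam hd hd2 hF1 hμ0
    hLF hper
  have hLdiff : Differentiable ℝ L := hL.differentiable hr0
  have hLm : StrictMono L := strictMono_of_deriv_pos hLpos
  set c := L 1 - L 0 with hc
  have hc0 : 0 < c := sub_pos.2 (hLm one_pos)
  have hL1 : ∀ t, L (t + 1) = L t + c := by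
    have : (fun t => L (t + 1)) = fun t => L t + c := by
      refine eq_of_hasDerivAt_eq (f' := deriv L) (x := 0) (fun t => ?_)
        (fun t => (hLdiff t).hasDerivAt.add_const c) (by simp [hc])
      rw [← hLper t]
      exact (hLdiff (t + 1)).hasDerivAt.comp_add_const t 1
    exact congrFun this
  have hHm : StrictMono fun t => L t / c := fun s t h => div_lt_div_of_pos_right (hLm h) hc0
  have hH1 : ∀ t, L (t + 1) / c = L t / c + 1 := fun t => by
    rw [hL1, add_div, div_self hc0.ne']
  have hHs : ContDiff ℝ r fun t => L t / c := hL.div_const c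
  let H : ℝ ≃ₜ ℝ := (StrictMono.orderIsoOfSurjective _ hHm
    (surjective_of_add_one hHs.continuous one_pos hH1)).toHomeomorph
  -- Evaluate L ∘ F at 0 and at 1: the increment is d · c by the degree and μ · c by the
  -- linearization.
  have hμd : μ = d := by
    have h1 := hLF (0 + 1)
    have h2 := apply_add_int hL1 d (F 0)
    push_cast at h2
    rw [hF1, h2, hLF, hL1] at h1
    exact mul_left_cancel₀ hc0.ne' (by linarith)
  refine ⟨H, hHs, ?_, hH1, fun t => ?_⟩
  · exact H.contDiff_symm_deriv (f' := fun t => deriv L t / c)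
      (fun t => (div_pos (hLpos t) hc0).ne') (fun t => (hLdiff t).hasDerivAt.div_const c) hHs
  · change L (F t) / c = d * (L t / c)
    rw [hLF, hμd]; ring

/-- F(t) - t grows by d - 1 > 0 over a unit step, so F has a fixed point p. Conjugating by the
translation by p moves it to 0 and preserves degree, expansion and multipliers. -/
theorem exists_homeomorph_semiconj_mul {r : ℕ∞} (hr : 2 ≤ r) {F : ℝ → ℝ} (hF : ContDiff ℝ r F)
    {lam : ℝ} (hlam : 1 < lam) (hd : ∀ t, lam ≤ deriv F t) {d : ℕ} (hd2 : 2 ≤ d)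
    (hF1 : ∀ t, F (t + 1) = F t + d) {μ : ℝ}
    (hper : ∀ (k : ℕ) (n : ℤ) (t : ℝ), 0 < k → F^[k] t = t + n → deriv F^[k] t = μ ^ k) :
    ∃ H : ℝ ≃ₜ ℝ, ContDiff ℝ r H ∧ ContDiff ℝ r H.symm ∧ (∀ t, H (t + 1) = H t + 1) ∧
      ∀ t, H (F t) = d * H t := by
  obtain ⟨p, hp⟩ : ∃ p, F p = p := by
    obtain ⟨p, hp⟩ := surjective_of_add_one (F := fun t => F t - t) (c := d - 1)
      (hF.continuous.sub continuous_id)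
      (sub_pos.2 (by exact_mod_cast (by omega : 1 < d))) (fun t => by rw [hF1]; ring) 0
    exact ⟨p, sub_eq_zero.1 hp⟩
  have hit : ∀ k t, (fun t => F (t + p) - p)^[k] t = F^[k] (t + p) - p := by
    intro k t
    induction k with
    | zero => simp
    | succ k ih => rw [Function.iterate_succ_apply', Function.iterate_succ_apply', ih]; simp
  have hder : ∀ k t, deriv (fun t => F (t + p) - p)^[k] t = deriv F^[k] (t + p) := by
    intro k t
    rw [funext (hit k), deriv_sub_const, deriv_comp_add_const]
  obtain ⟨H, hH, hHs, hH1, hHF⟩ := exists_homeomorph_semiconj_mul_of_fixed_zero hr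
    (F := fun t => F (t + p) - p) (lam := lam) (d := d) (μ := μ)
    ((hF.comp (contDiff_id.add contDiff_const)).sub contDiff_const) (by simp [hp]) hlam
    (fun t => by have := hder 1 t; simp only [Function.iterate_one] at this; rw [this]; exact hd _)
    hd2 (fun t => by rw [add_right_comm, hF1]; ring)
    (fun k n t hk h => by
      rw [hder]
      refine hper k n _ hk ?_
      rw [hit] at h
      linarith)
  refine ⟨(Homeomorph.addRight (-p)).trans H, hH.comp (contDiff_id.add contDiff_const), ?_,
    fun t => ?_, fun t => ?_⟩
  · have : ⇑((Homeomorph.addRight (-p)).trans H).symm = fun t => H.symm t + p := by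
      funext t
      change H.symm t + - -p = _
      rw [neg_neg]
    rw [this]
    exact hHs.add contDiff_const
  · simp only [Homeomorph.trans_apply, Homeomorph.coe_addRight]
    rw [add_right_comm, hH1]
  · simp only [Homeomorph.trans_apply, Homeomorph.coe_addRight]
    have := hHF (t + -p)
    simpa [sub_eq_add_neg] using this


/-! ### Passage between circle maps and their lifts -/

lemma rep_coe {y : ℝ} (h₁ : -1 / 2 ≤ y) (h₂ : y < 1 / 2) : rep (y : UnitAddCircle) = y := by
  have hy : y ∈ Set.Ico (-1 / 2 : ℝ) (-1 / 2 + 1) := ⟨h₁, by linarith⟩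
  unfold rep
  rw [AddCircle.equivIco_coe_eq hy]

/-- For small t the increment F(s + t) - F(s) lies in (-1/2, 1/2), where the chart `rep` undoes the
projection. -/
lemma circleDeriv_coe {F : ℝ → ℝ} {f : UnitAddCircle → UnitAddCircle} (h : IsLift F f) (s : ℝ) :
    circleDeriv f s = deriv F s := by
  have hev : (fun t : ℝ => rep (f (s + (t : UnitAddCircle)) - f s))
      =ᶠ[𝓝 0] fun t => F (s + t) - F s := by
    have hc : Tendsto (fun t => F (s + t) - F s) (𝓝 0) (𝓝 0) := by
      have : Continuous fun t => F (s + t) - F s := by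
        have := h.1
        fun_prop
      simpa using this.tendsto 0
    filter_upwards [hc.eventually (Ioo_mem_nhds (by norm_num : (-1 / 2 : ℝ) < 0)
      (by norm_num : (0 : ℝ) < 1 / 2))] with t ht
    rw [← AddCircle.coe_add, ← h.2, ← h.2, ← AddCircle.coe_sub, rep_coe ht.1.le ht.2]
  unfold circleDeriv
  rw [hev.deriv_eq, deriv_sub_const, deriv_comp_const_add, add_zero]

lemma IsLift.comp {F G : ℝ → ℝ} {f g : UnitAddCircle → UnitAddCircle} (hF : IsLift F f)
    (hG : IsLift G g) : IsLift (F ∘ G) (f ∘ g) :=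
  ⟨hF.1.comp hG.1, fun t => by simp only [Function.comp, hF.2, hG.2]⟩

lemma IsLift.iterate {F : ℝ → ℝ} {f : UnitAddCircle → UnitAddCircle} (h : IsLift F f) (n : ℕ) :
    IsLift F^[n] f^[n] := by
  induction n with
  | zero => exact ⟨continuous_id, fun _ => rfl⟩
  | succ n ih => rw [Function.iterate_succ', Function.iterate_succ']; exact h.comp ih

/-- The difference of two lifts is continuous and integer-valued on a connected space. -/
lemma IsLift.exists_int {F₁ F₂ : ℝ → ℝ} {f : UnitAddCircle → UnitAddCircle} (h₁ : IsLift F₁ f)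
    (h₂ : IsLift F₂ f) : ∃ n : ℤ, ∀ t, F₁ t = F₂ t + n := by
  have hex : ∀ t, ∃ n : ℤ, (n : ℝ) = F₁ t - F₂ t := fun t => by
    have : ((F₁ t - F₂ t : ℝ) : UnitAddCircle) = 0 := by
      rw [AddCircle.coe_sub, h₁.2, h₂.2, sub_self]
    obtain ⟨n, hn⟩ := (AddCircle.coe_eq_zero_iff (1 : ℝ)).1 this
    exact ⟨n, by simpa using hn⟩
  choose n hn using hex
  have hc : Continuous n := by
    rw [Int.isClosedEmbedding_coe_real.isEmbedding.continuous_iff,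
      show Int.cast ∘ n = fun t => F₁ t - F₂ t from funext hn]
    exact h₁.1.sub h₂.1
  refine ⟨n 0, fun t => ?_⟩
  rw [PreconnectedSpace.constant inferInstance hc (x := 0) (y := t), hn]
  ring

lemma IsLift.apply_add_one {F : ℝ → ℝ} {f : UnitAddCircle → UnitAddCircle} (h : IsLift F f)
    {d : ℤ} (hd : HasDegree f d) (t : ℝ) : F (t + 1) = F t + d := by
  obtain ⟨F', hF', hd'⟩ := hd
  obtain ⟨n, hn⟩ := h.exists_int hF'
  rw [hn, hn, hd']
  ring

lemma coe_add_intCast (t : ℝ) (n : ℤ) : ((t + n : ℝ) : UnitAddCircle) = t := by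
  rw [AddCircle.coe_add, add_eq_left, AddCircle.coe_eq_zero_iff]
  exact ⟨n, by simp⟩

lemma exists_continuous_descent {H : ℝ → ℝ} (hc : Continuous H) (h : ∀ t, H (t + 1) = H t + 1) :
    ∃ g : UnitAddCircle → UnitAddCircle, Continuous g ∧ IsLift H g := by
  have hp : Function.Periodic (fun t => (H t : UnitAddCircle)) 1 := fun t => by
    simp only [h t]
    simp
  refine ⟨hp.lift, ?_, hc, fun t => rfl⟩
  exact isQuotientMap_quotient_mk'.continuous_iff.2
    ((AddCircle.continuous_mk' 1).comp hc)

lemma exists_homeomorph_descent (H : ℝ ≃ₜ ℝ) (h : ∀ t, H (t + 1) = H t + 1) :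
    ∃ g : UnitAddCircle ≃ₜ UnitAddCircle, IsLift H g ∧ IsLift H.symm g.symm := by
  obtain ⟨g, hgc, hg⟩ := exists_continuous_descent H.continuous h
  obtain ⟨k, hkc, hk⟩ := exists_continuous_descent H.symm.continuous fun t => by
    apply H.injective
    rw [h, H.apply_symm_apply, H.apply_symm_apply]
  refine ⟨⟨⟨g, k, fun x => ?_, fun x => ?_⟩, hgc, hkc⟩, hg, hk⟩
  · induction x using QuotientAddGroup.induction_on with
    | H t =>
      rw [← hg.2, ← hk.2, H.symm_apply_apply]
  · induction x using QuotientAddGroup.induction_on with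
    | H t =>
      rw [← hk.2, ← hg.2, H.apply_symm_apply]

lemma isLift_linearModel (d : ℕ) : IsLift (fun t => d * t) (linearModel d) :=
  ⟨continuous_const.mul continuous_id, fun t => by
    unfold linearModel
    rw [← AddCircle.coe_nsmul, nsmul_eq_mul]⟩

lemma isLift_linearModel_iterate (d n : ℕ) :
    IsLift (fun t => (d : ℝ) ^ n * t) (linearModel d)^[n] := by
  have h := (isLift_linearModel d).iterate n
  rwa [show (fun t : ℝ => (d : ℝ) * t)^[n] = fun t => (d : ℝ) ^ n * t from
    funext fun t => by rw [mul_left_iterate]] at h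

/-! ### Lyapunov exponents, multipliers and the two implications -/

lemma deriv_iterate_pos {F : ℝ → ℝ} (hF : ContDiff ℝ 1 F) (h : ∀ t, 0 < deriv F t) (k : ℕ)
    (t : ℝ) : 0 < deriv F^[k] t := by
  induction k generalizing t with
  | zero => simp
  | succ k ih =>
    rw [Function.iterate_succ', deriv_comp t (hF.differentiable one_ne_zero _)
      ((contDiff_iterate hF k).differentiable one_ne_zero _)]
    exact mul_pos (h _) (ih t)

lemma deriv_iterate_mul {F : ℝ → ℝ} (hF : ContDiff ℝ 1 F) {f : UnitAddCircle → UnitAddCircle}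
    (h : IsLift F f) {k : ℕ} {t : ℝ} (ht : Function.IsPeriodicPt f k t) (m : ℕ) :
    deriv F^[m * k] t = deriv F^[k] t ^ m := by
  induction m with
  | zero => simp
  | succ m ih =>
    have hd : ∀ j, Differentiable ℝ F^[j] := fun j =>
      (contDiff_iterate hF j).differentiable one_ne_zero
    rw [add_one_mul, add_comm, Function.iterate_add, deriv_comp t (hd _ _) (hd _ _), ih,
      ← circleDeriv_coe (h.iterate k), (h.iterate (m * k)).2, (ht.const_mul m).eq,
      circleDeriv_coe (h.iterate k)]
    ring

/-- Along the times (m + 1)k the averages are constant, equal to the logarithm of the multiplier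
divided by k, so this value is the limit l. Using m + 1 avoids time 0. -/
lemma deriv_iterate_eq_exp_pow {F : ℝ → ℝ} (hF : ContDiff ℝ 1 F)
    {f : UnitAddCircle → UnitAddCircle} (h : IsLift F f) (hpos : ∀ t, 0 < deriv F t) {k : ℕ}
    (hk : 0 < k) {t : ℝ} (ht : Function.IsPeriodicPt f k t) {l : ℝ}
    (hl : HasLyapunovExponent f t l) : deriv F^[k] t = Real.exp l ^ k := by
  have hD := deriv_iterate_pos hF hpos k t
  have hk0 : (k : ℝ) ≠ 0 := by exact_mod_cast hk.ne'
  have hsub : Tendsto (fun m : ℕ => (m + 1) * k) atTop atTop :=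
    tendsto_atTop_mono (fun m => m.le_succ.trans (Nat.le_mul_of_pos_right _ hk))
      tendsto_id
  have h1 := hl.comp hsub
  have h2 : ((fun n : ℕ => (1 / (n : ℝ)) * Real.log |circleDeriv (f^[n]) t|) ∘
      fun m : ℕ => (m + 1) * k) = fun _ => Real.log (deriv F^[k] t) / k := by
    funext m
    simp only [Function.comp]
    rw [circleDeriv_coe (h.iterate _), deriv_iterate_mul hF h ht, abs_of_pos (pow_pos hD _),
      Real.log_pow]
    have : ((m + 1 : ℕ) : ℝ) ≠ 0 := by positivity
    push_cast at this ⊢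
    field_simp
  rw [h2] at h1
  have h3 := tendsto_nhds_unique h1 tendsto_const_nhds
  rw [← Real.exp_nat_mul, h3, mul_div_cancel₀ _ hk0, Real.exp_log hD]

theorem hasLyapunovExponent_of_crConjugate {r : ℕ∞} (hr : 1 ≤ r) {d : ℕ} (hd : 1 ≤ d)
    {f : UnitAddCircle → UnitAddCircle} (hf : IsCr r f)
    (h : CrConjugate r f (linearModel d)) (p : UnitAddCircle) :
    HasLyapunovExponent f p (Real.log d) := by
  obtain ⟨g, ⟨K, hK, hKs⟩, ⟨J, hJ, hJs⟩, hconj⟩ := h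
  obtain ⟨F, hF, hFs⟩ := hf
  have hr1 : (1 : ℕ∞ω) ≤ r := by exact_mod_cast hr
  have hF1 := hFs.of_le hr1
  have hK1 := hKs.of_le hr1
  have hKd : Differentiable ℝ K := hK1.differentiable one_ne_zero
  have hJd : Differentiable ℝ J := (hJs.of_le hr1).differentiable one_ne_zero
  have hd0 : (0 : ℝ) < d := by exact_mod_cast hd
  -- J ∘ K lifts the identity of the circle, so its derivative is 1.
  have hK0 : ∀ s, deriv K s ≠ 0 := fun s hs => by
    have h1 : circleDeriv (g.symm ∘ g) s = deriv (J ∘ K) s := circleDeriv_coe (hJ.comp hK) s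
    have h2 : circleDeriv (g.symm ∘ g) s = deriv id s := by
      rw [g.symm_comp_self]
      exact circleDeriv_coe ⟨continuous_id, fun _ => rfl⟩ s
    rw [h1, deriv_comp s (hJd _) (hKd _), hs, mul_zero, deriv_id] at h2
    exact zero_ne_one h2
  have hKper : Function.Periodic (fun s => Real.log |deriv K s|) 1 := fun s => by
    have := coe_add_intCast s 1
    simp only [Int.cast_one] at this
    simp only
    rw [← circleDeriv_coe hK, this, circleDeriv_coe hK]
  obtain ⟨M, hM⟩ := (hKper.isBounded_of_continuous one_ne_zero
    ((hK1.continuous_deriv le_rfl).abs.log fun s => abs_ne_zero.2 (hK0 s))).exists_norm_le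
  replace hM : ∀ s, |(Real.log |deriv K s|)| ≤ M := fun s => hM _ ⟨s, rfl⟩
  obtain ⟨s, hs⟩ : ∃ s : ℝ, g s = p := by
    obtain ⟨s, hs⟩ := QuotientAddGroup.mk_surjective (g.symm p)
    exact ⟨s, (congrArg g hs).trans (g.apply_symm_apply p)⟩
  -- Differentiating f^n ∘ g = g ∘ E_d^n at s gives n log d plus a coboundary, bounded by 2M because
  -- log |K'| is periodic and continuous.
  have hlog : ∀ n : ℕ, Real.log |circleDeriv f^[n] p| =
      n * Real.log d + (Real.log |deriv K (d ^ n * s)| - Real.log |deriv K s|) := by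
    intro n
    have hsemi : f^[n] ∘ g = g ∘ (linearModel d)^[n] := funext fun x =>
      (Function.Semiconj.iterate_right (f := g) (fun x => (hconj x).symm) n x).symm
    have hFd := (contDiff_iterate hF1 n).differentiable one_ne_zero
    have h1 := circleDeriv_coe ((hF.iterate n).comp hK) s
    have h2 := circleDeriv_coe (hK.comp (isLift_linearModel_iterate d n)) s
    rw [hsemi, h2, deriv_comp s (hFd _) (hKd _), deriv_comp s (hKd _) (by fun_prop),
      ← circleDeriv_coe (hF.iterate n), hK.2, hs, deriv_const_mul_field, deriv_id'', mul_one] at h1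
    have hne : circleDeriv f^[n] p ≠ 0 := fun h0 => by
      rw [h0, zero_mul] at h1
      exact mul_ne_zero (hK0 _) (pow_pos hd0 n).ne' h1
    have h3 := congrArg (fun x => Real.log |x|) h1
    simp only [abs_mul] at h3
    rw [Real.log_mul (abs_ne_zero.2 (hK0 _)) (abs_ne_zero.2 (pow_pos hd0 n).ne'),
      Real.log_mul (abs_ne_zero.2 hne) (abs_ne_zero.2 (hK0 _)), abs_of_pos (pow_pos hd0 n),
      Real.log_pow] at h3
    linarith
  unfold HasLyapunovExponent
  rw [tendsto_iff_norm_sub_tendsto_zero]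
  refine squeeze_zero' (Eventually.of_forall fun n => norm_nonneg _) ?_
    (tendsto_const_div_atTop_nhds_zero_nat (M + M))
  filter_upwards [eventually_gt_atTop 0] with n hn
  have hn0 : (0 : ℝ) < n := by exact_mod_cast hn
  rw [hlog, show 1 / (n : ℝ) * (n * Real.log d
    + (Real.log |deriv K (d ^ n * s)| - Real.log |deriv K s|)) - Real.log d
    = (Real.log |deriv K (d ^ n * s)| - Real.log |deriv K s|) / n by field_simp; ring,
    Real.norm_eq_abs, abs_div, abs_of_pos hn0]
  exact div_le_div_of_nonneg_right ((abs_sub _ _).trans (add_le_add (hM _) (hM _))) hn0.le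

theorem crConjugate_of_hasLyapunovExponent {r : ℕ∞} (hr : 2 ≤ r) {d : ℕ} (hd : 2 ≤ d)
    {f : UnitAddCircle → UnitAddCircle} (hf : IsCr r f) (hdeg : HasDegree f d)
    (hor : IsOrientationPreserving f) (hexp : IsExpanding f) {l : ℝ}
    (hl : ∀ p ∈ Function.periodicPts f, HasLyapunovExponent f p l) :
    CrConjugate r f (linearModel d) := by
  obtain ⟨F, hF, hFs⟩ := hf
  obtain ⟨lam, hlam, hlt⟩ := hexp
  have hF1 : ContDiff ℝ 1 F := hFs.of_le (by exact_mod_cast (one_le_two.trans hr))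
  have hder : ∀ t, lam ≤ deriv F t := fun t => by
    have h1 := hor t
    have h2 := hlt t
    rw [abs_of_pos h1, circleDeriv_coe hF] at h2
    exact h2.le
  have hpos : ∀ t, 0 < deriv F t := fun t => (one_pos.trans hlam).trans_le (hder t)
  obtain ⟨H, hHs, hHs', hH1, hHF⟩ := exists_homeomorph_semiconj_mul hr hFs hlam hder hd
    (by simpa using hF.apply_add_one hdeg) (μ := Real.exp l) fun k n t hk ht => by
      have hp : Function.IsPeriodicPt f k (t : UnitAddCircle) := by
        change f^[k] t = t
        rw [← (hF.iterate k).2, ht, coe_add_intCast]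
      exact deriv_iterate_eq_exp_pow hF1 hF hpos hk hp (hl _ ⟨k, hk, hp⟩)
  obtain ⟨g, hg, hg'⟩ := exists_homeomorph_descent H hH1
  -- H carries F to multiplication by d, whereas the conjugacy sought goes from the linear model to
  -- f; hence the inverse.
  refine ⟨g.symm, ⟨_, hg', hHs'⟩, ⟨_, hg, hHs⟩, fun x => ?_⟩
  induction x using QuotientAddGroup.induction_on with
  | H t =>
    rw [← hg'.2, ← hF.2, ← (isLift_linearModel d).2, ← hg'.2]
    congr 1
    apply H.injective
    rw [hHF, H.apply_symm_apply, H.apply_symm_apply]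

end CircleDynamics

end

theorem theorem1 (r : ℕ∞) (hr : 2 ≤ r) (d : ℕ) (hd : 2 ≤ d)
    (f : UnitAddCircle → UnitAddCircle)
    (hf : CircleDynamics.IsCr r f)
    (hdeg : CircleDynamics.HasDegree f (d : ℤ))
    (hor : CircleDynamics.IsOrientationPreserving f)
    (hexp : CircleDynamics.IsExpanding f) :
    CircleDynamics.CrConjugate r f (CircleDynamics.linearModel d) ↔
      ∃ l : ℝ, ∀ p ∈ Function.periodicPts f, CircleDynamics.HasLyapunovExponent f p l := by
  constructor
  · exact fun h => ⟨Real.log d, fun p _ =>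
      CircleDynamics.hasLyapunovExponent_of_crConjugate (one_le_two.trans hr)
        (one_le_two.trans hd) hf h p⟩
  · rintro ⟨l, hl⟩
    exact CircleDynamics.crConjugate_of_hasLyapunovExponent hr hd hf hdeg hor hexp hl
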